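/- **Disk.** Let $\mathbb D=\{z\in\mathbb C:|z|<1\}$, $\mathbb S=\partial\mathbb D$, and let $G_{\mathbb D}(z,w)=\log\frac{|1-z\bar w|}{|z-w|}$ (with value $+\infty$ for $z=w$). Let $E\subset\mathbb S$, let $\mathrm{dist}$ be the Euclidean distance, with $\mathrm{dist}(z,\emptyset)=+\infty$, and for $0<t<1$ let $\mathbb D^{(t)}$ be the connected component of $0$ in $\{z\in\mathbb D:\mathrm{dist}(z,E)>t\}$. Let $G_{\mathbb D^{(t)}}$ be the Green function of the domain $\mathbb D^{(t)}$: $G_{\mathbb D^{(t)}}(\cdot,w)$ is $\log\frac1{|\cdot-w|}$ minus its greatest harmonic minorant on $\mathbb D^{(t)}$, with value $+\infty$ at $w$. Then for every $0<t<1/7$ and every $z\in\mathbb D^{(7t)}$, $$G_{\mathbb D}(z,0)\ \ge\ G_{\mathbb D^{(t)}}(z,0)\ \ge\ \tfrac1{18}\,G_{\mathbb D}(z,0)\ \ge\ \tfrac1{18}\,\mathrm{dist}(z,\mathbb S).$$ **Tree.** Let $q\ge 2$ be an integer, let $\mathbb T$ be the homogeneous tree in which every vertex has $q+1$ neighbours,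 with graph distance $d$ and root $o$, and let $G_{\mathbb T}(x,y)=\frac{q}{q-1}\,q^{-d(x,y)}$. Let $\partial\mathbb T$ be the set of ends of $\mathbb T$, that is, of classes of geodesic rays that differ only by finite initial pieces. For $z\neq w$ in $\mathbb T\cup\partial\mathbb T$ put $\rho(z,w)=q^{-|z\wedge w|}$, where $|z\wedge w|$ is the distance from $o$ to the last common vertex of the geodesics from $o$ to $z$ and from $o$ to $w$; put $\rho(z,z)=0$. For $E\subset\partial\mathbb T$ let $\rho(x,E)=\inf_{\xi\in E}\rho(x,\xi)$ (equal to $+\infty$ if $E=\emptyset$), and for $0<t<1$ let $\mathbb T^{(t)}$ be the connected component of $o$ in $\{x\in\mathbb T:\rho(x,E)>t\}$. For $x,y\in\mathbb T^{(t)}$ let $G_{\mathbb T^{(t)}}(x,y)$ be the expected number of visits to $y$ of the simple random walk on $\mathbb T$ started at $x$, before it leaves $\mathbb T^{(t)}$. Then for every $E\subset\partial\mathbb T$, every $0<t<1$ and every $x\in\mathbb T^{(t)}$, $$G_{\mathbb T}(x,o)\ \ge\ G_{\mathbb T^{(t)}}(x,o)\ \ge\ \tfrac{q-1}{q}\,G_{\mathbb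 T}(x,o)\ \ge\ \rho(x,\partial\mathbb T).$$ -/

import Mathlib

open scoped ENNReal

namespace DiskTree

/-! ## The disk -/

/-- The Green function of the unit disk, `G(z,w) = log (|1 - z w̄| / |z - w|)`, equal to `+∞` on the
diagonal. It is nonnegative, so `ENNReal.ofReal` does not truncate for `z, w` in the disk. -/
noncomputable def diskGreen (z w : ℂ) : ℝ≥0∞ :=
  open Classical in
  if z = w then ⊤ else ENNReal.ofReal (Real.log (‖1 - z * star w‖ / ‖z - w‖))

/-- The truncated disk: the component of the origin in
`{z : |z| < 1 and the Euclidean distance from z to E is greater than t}`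
(the distance to the empty set is `+∞`). -/
noncomputable def truncatedDisk (E : Set ℂ) (t : ℝ) : Set ℂ :=
  connectedComponentIn {z ∈ Metric.ball (0 : ℂ) 1 | ENNReal.ofReal t < Metric.infEDist z E} 0

/-- `h` is a harmonic minorant on `Ω` of the function `z ↦ log (1 / |z - w|)`
(whose value at `w` is `+∞`, so that there is no constraint at `w`). -/
def IsHarmonicMinorant (Ω : Set ℂ) (w : ℂ) (h : ℂ → ℝ) : Prop :=
  InnerProductSpace.HarmonicOnNhd h Ω ∧ ∀ z ∈ Ω, z ≠ w → h z ≤ Real.log (1 / ‖z - w‖)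

/-- The Green function of a bounded planar domain `Ω`, for `z, w ∈ Ω`: it is
`log (1 / |z - w|)` minus the greatest harmonic minorant of this function of `z` on `Ω`, and `+∞` on
the diagonal. The greatest harmonic minorant is taken as the pointwise supremum of all harmonic
minorants. Off the diagonal the supremum is at most `log (1 / |z - w|)`, so `ENNReal.ofReal` does
not truncate. -/
noncomputable def domainGreen (Ω : Set ℂ) (z w : ℂ) : ℝ≥0∞ :=
  open Classical in
  if z = w then ⊤
  else ENNReal.ofReal
    (Real.log (1 / ‖z - w‖) - sSup {s : ℝ | ∃ h : ℂ → ℝ, IsHarmonicMinorant Ω w h ∧ s = h z})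

/-! ## The tree -/

section Tree

variable {V : Type*} (G : SimpleGraph V)

/-- A geodesic ray: a one-sided infinite sequence of distinct, successively adjacent vertices. -/
structure Ray where
  vert : ℕ → V
  adj : ∀ n, G.Adj (vert n) (vert (n + 1))
  inj : Function.Injective vert

/-- Two rays are equivalent if they differ only by finite initial pieces. -/
instance raySetoid : Setoid (Ray G) where
  r a b := ∃ m n : ℕ, ∀ k, a.vert (m + k) = b.vert (n + k)
  iseqv :=
    { refl := fun _ => ⟨0, 0, fun _ => rfl⟩
      symm := fun ⟨m, n, h⟩ => ⟨n, m, fun k => (h k).symm⟩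
      trans := by
        rintro a b c ⟨m, n, h⟩ ⟨m', n', h'⟩
        refine ⟨m + m', n' + n, fun k => ?_⟩
        rw [add_assoc, h, add_assoc, ← h']
        congr 1
        omega }

/-- The boundary of the tree: the set of ends, i.e. equivalence classes of rays. -/
def Ends : Type _ := Quotient (raySetoid G)

/-- The set of vertices on the geodesic from the root `o` to a vertex or to an end. -/
def rootGeodesic (o : V) : V ⊕ Ends G → Set V
  | Sum.inl x => {y | ∃ p : G.Walk o x, p.IsPath ∧ y ∈ p.support}
  | Sum.inr ξ => {y | ∃ r : Ray G, (Quotient.mk (raySetoid G) r : Ends G) = ξ ∧ r.vert 0 = o ∧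
      ∃ n, r.vert n = y}

/-- The distance `|z ∧ w|` from the root `o` to the confluent `z ∧ w`, the last common vertex of the
geodesics from `o` to `z` and to `w` (for `z ≠ w`). -/
noncomputable def confluentLength (o : V) (z w : V ⊕ Ends G) : ℕ :=
  sSup (G.dist o '' (rootGeodesic G o z ∩ rootGeodesic G o w))

/-- The length metric on the end compactification: `q ^ (-|z ∧ w|)` if `z ≠ w`, and `0` if
`z = w`. -/
noncomputable def lengthMetric (q : ℕ) (o : V) (z w : V ⊕ Ends G) : ℝ :=
  open Classical in
  if z = w then 0 else ((q : ℝ) ^ confluentLength G o z w)⁻¹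

/-- The distance, in the length metric, from a vertex `x` to a set `E` of ends (`+∞` for empty
`E`). -/
noncomputable def distToEnds (q : ℕ) (o x : V) (E : Set (Ends G)) : ℝ≥0∞ :=
  ⨅ ξ ∈ E, ENNReal.ofReal (lengthMetric G q o (Sum.inl x) (Sum.inr ξ))

/-- The truncated tree: the component of the root `o` in the set of vertices whose distance to `E`
is greater than `t`. -/
def truncatedTree (q : ℕ) (o : V) (E : Set (Ends G)) (t : ℝ) : Set V :=
  {x | ∃ p : G.Walk o x, ∀ y ∈ p.support, ENNReal.ofReal t < distToEnds G q o y E}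

/-- The Green function `(q / (q - 1)) * q ^ (-d(x,y))` of the homogeneous tree of degree
`q + 1`. -/
noncomputable def treeGreen (q : ℕ) (x y : V) : ℝ≥0∞ :=
  ENNReal.ofReal ((q : ℝ) / ((q : ℝ) - 1) * ((q : ℝ) ^ G.dist x y)⁻¹)

/-- The probability that the simple random walk started at `x` is at `y` at time `n` and has stayed
in the set `A` at all times `0, …, n`. -/
noncomputable def killedWalkProb [G.LocallyFinite] (A : Set V) (y : V) : ℕ → V → ℝ≥0∞
  | 0, x => open Classical in if x ∈ A ∧ x = y then 1 else 0
  | n + 1, x => open Classical in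
      if x ∈ A then ∑ z ∈ G.neighborFinset x, (G.degree x : ℝ≥0∞)⁻¹ * killedWalkProb A y n z else 0

/-- The Green function of a set `A` of vertices: the expected number of visits to `y` of the simple
random walk started at `x`, before it leaves `A`. -/
noncomputable def subsetGreen [G.LocallyFinite] (A : Set V) (x y : V) : ℝ≥0∞ :=
  ∑' n, killedWalkProb G A y n x

end Tree

end DiskTree

/-! Disk. The upper bound holds because 0 is a harmonic minorant. For the lower bound, every
harmonic minorant `h` must satisfy `h z ≤ 17/18 * log (1/‖z‖)`. The truncated disk contains the disk
of radius `1 - t`, so `h ≤ m = log (1/(1 - t))` by the maximum principle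
(`IsHarmonicMinorant.le_log`). If `‖z‖ ≤ 1 - 2t`, then `log (1/‖z‖) ≥ 2m` and this is enough.
Otherwise all of the disk within `6t` of `z` is available, and a barrier on a half-disk-like region
at `ζ = z/‖z‖` (`IsHarmonicMinorant.le_of_near_circle`) shows that `h` decays linearly towards the
circle.

Tree. Both bounds come from comparing the killed Green function with super- and subsolutions of the
Poisson equation. The full Green function is a supersolution. For the lower bound, let `m` be the
last level with `q^(-m) > t`. Up to level `m` use the Green function `g` of the ball of radius `m`;
on the part of the truncated tree beyond it use `q^(-d)`, harmonic off the root. The two agree at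
level `m`, and past that level the truncated tree keeps all children of its vertices, so the glued
function is a subsolution. It dominates `q^(-d)`, which is `(q-1)/q` times the full Green function.
-/

namespace DiskTree

open Metric Filter Topology InnerProductSpace

/-! ### Harmonic minorants: maximum principle and global bound -/

/-- The maximum principle for harmonic functions on a neighbourhood of a compact set. -/
theorem le_of_forall_mem_frontier_le {K : Set ℂ} (hK : IsCompact K) {h : ℂ → ℝ} {M : ℝ}
    (hh : HarmonicOnNhd h K) (hM : ∀ w ∈ frontier K, h w ≤ M) {z : ℂ} (hz : z ∈ K) : h z ≤ M := by
  by_contra! hlt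
  obtain ⟨x₀, hx₀, hmax⟩ := hK.exists_isMaxOn ⟨z, hz⟩ hh.continuousOn
  have hS : IsCompact (K ∩ h ⁻¹' {h x₀}) := by
    refine hK.of_isClosed_subset ?_ Set.inter_subset_left
    exact hh.continuousOn.preimage_isClosed_of_isClosed hK.isClosed isClosed_singleton
  -- Among the maximum points take one of largest real part: local constancy at an interior maximum
  -- then yields a maximum point further right, a contradiction.
  obtain ⟨x₁, hx₁, hre⟩ := hS.exists_isMaxOn ⟨x₀, hx₀, rfl⟩ Complex.continuous_re.continuousOn
  have hx₁v : h x₁ = h x₀ := hx₁.2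
  have hint : x₁ ∈ interior K := by
    by_contra hni
    have := hM x₁ ⟨subset_closure hx₁.1, hni⟩
    have := hmax hz
    simp only [Set.mem_ofPred_eq] at this
    linarith
  have hev : ∀ᶠ w in 𝓝 x₁, w ∈ interior K ∧ HarmonicAt h w :=
    Filter.Eventually.and (isOpen_interior.mem_nhds hint) (HarmonicAt.eventually (hh x₁ hx₁.1))
  obtain ⟨r, hr, hball⟩ := Metric.eventually_nhds_iff_ball.1 hev
  obtain ⟨F, hF, hFre⟩ := HarmonicOnNhd.exists_analyticOnNhd_ball_re_eq
    (f := h) (z := x₁) (R := r) (fun w hw => (hball w hw).2)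
  have hnorm : ∀ w ∈ ball x₁ r, ‖Complex.exp (F w)‖ = Real.exp (h w) := fun w hw => by
    rw [Complex.norm_exp]
    exact congrArg Real.exp (hFre hw)
  have hmem : ball x₁ r ∈ 𝓝 x₁ := ball_mem_nhds _ hr
  have hconst := Complex.norm_eventually_eq_of_isLocalMax (f := fun w => Complex.exp (F w)) (c := x₁)
    (by
      filter_upwards [hmem] with w hw
      exact (hF w hw).differentiableAt.cexp)
    (by
      filter_upwards [hmem] with w hw
      simp only [Function.comp]
      rw [hnorm w hw, hnorm x₁ (mem_ball_self hr), hx₁v]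
      exact Real.exp_le_exp.2 (hmax (interior_subset (hball w hw).1)))
  obtain ⟨δ, hδ, hδball⟩ := Metric.eventually_nhds_iff_ball.1 (hconst.and hmem)
  have hy : x₁ + ((δ / 2 : ℝ) : ℂ) ∈ ball x₁ δ := by
    rw [mem_ball, dist_eq_norm, add_sub_cancel_left, Complex.norm_real, Real.norm_eq_abs,
      abs_of_pos (by positivity)]
    linarith
  obtain ⟨h1, h2⟩ := hδball _ hy
  rw [hnorm _ h2, hnorm x₁ (mem_ball_self hr)] at h1
  have h3 := hre (⟨interior_subset (hball _ h2).1, (Real.exp_injective h1).trans hx₁v⟩ :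
    x₁ + ((δ / 2 : ℝ) : ℂ) ∈ K ∩ h ⁻¹' {h x₀})
  simp only [Set.mem_ofPred_eq, Complex.add_re, Complex.ofReal_re] at h3
  linarith

/-- A harmonic minorant on a domain containing the disk of radius `1 - t` is bounded by
`log (1 / (1 - t))`. -/
theorem IsHarmonicMinorant.le_log {Ω : Set ℂ} {h : ℂ → ℝ} (hh : IsHarmonicMinorant Ω 0 h) {t : ℝ}
    (ht1 : t < 1) (hΩ : ball (0 : ℂ) (1 - t) ⊆ Ω) {z : ℂ} (hz : z ∈ Ω) :
    h z ≤ Real.log (1 / (1 - t)) := by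
  have h0 : 0 < 1 - t := by linarith
  rcases le_or_gt (1 - t) ‖z‖ with hzt | hzt
  · have hz0 : z ≠ 0 := norm_pos_iff.1 (h0.trans_le hzt)
    refine (hh.2 z hz hz0).trans ?_
    rw [sub_zero]
    exact Real.log_le_log (by positivity) (one_div_le_one_div_of_le h0 hzt)
  -- Only the open disk of radius `1 - t` is known to lie in `Ω`, so the bound is taken on smaller
  -- closed disks and passed to the limit.
  · have key : ∀ᶠ ρ in 𝓝[<] (1 - t), h z ≤ Real.log (1 / ρ) := by
      filter_upwards [Ioo_mem_nhdsLT hzt] with ρ hρ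
      have hρ0 : 0 < ρ := (norm_nonneg z).trans_lt hρ.1
      have hsub : closedBall (0 : ℂ) ρ ⊆ Ω := (closedBall_subset_ball hρ.2).trans hΩ
      refine le_of_forall_mem_frontier_le (isCompact_closedBall (0 : ℂ) ρ) (hh.1.mono hsub) ?_
        (by simpa using hρ.1.le)
      intro w hw
      rw [frontier_closedBall _ hρ0.ne', mem_sphere_zero_iff_norm] at hw
      have := hh.2 w (hsub (by simp [hw])) (norm_pos_iff.1 (hw ▸ hρ0))
      rwa [sub_zero, hw] at this
    have hlim : Tendsto (fun ρ : ℝ => Real.log (1 / ρ)) (𝓝[<] (1 - t))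
        (𝓝 (Real.log (1 / (1 - t)))) := by
      refine (ContinuousAt.tendsto ?_).mono_left nhdsWithin_le_nhds
      fun_prop (disch := first | positivity | exact h0.ne' | exact (one_div_pos.2 h0).ne')
    exact ge_of_tendsto hlim key

/-! ### The barrier near the unit circle -/

/-- The sum of the two Poisson kernels of the right half-plane with poles `± i R`. -/
noncomputable def twoPoleKernel (R : ℝ) (ψ : ℂ) : ℂ :=
  (ψ + R * Complex.I)⁻¹ + (ψ - R * Complex.I)⁻¹

theorem re_twoPoleKernel (R : ℝ) (ψ : ℂ) : (twoPoleKernel R ψ).re =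
    ψ.re / (ψ.re ^ 2 + (ψ.im + R) ^ 2) + ψ.re / (ψ.re ^ 2 + (ψ.im - R) ^ 2) := by
  simp [twoPoleKernel, Complex.inv_re, Complex.normSq_apply, sq]

theorem re_twoPoleKernel_nonneg (R : ℝ) {ψ : ℂ} (h : 0 ≤ ψ.re) : 0 ≤ (twoPoleKernel R ψ).re := by
  rw [re_twoPoleKernel]
  positivity

/-- On the half-circle the two denominators are `2R(R ± ψ.im)`, so the sum is exactly `1/ψ.re ≥
1/R`. Hence `R` times the kernel is a barrier for the half-disk: at least 1 on the arc, nonnegative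
inside, and zero on the diameter away from the poles. -/
theorem one_le_mul_re_twoPoleKernel {R : ℝ} {ψ : ℂ} (h : 0 < ψ.re) (hR : ‖ψ‖ = R) :
    1 ≤ R * (twoPoleKernel R ψ).re := by
  have hle : ψ.re ≤ R := hR ▸ Complex.re_le_norm ψ
  have hsq : ψ.re ^ 2 + ψ.im ^ 2 = R ^ 2 := by
    rw [← hR, Complex.sq_norm, Complex.normSq_apply]
    ring
  have : (twoPoleKernel R ψ).re = 1 / ψ.re := by
    rw [re_twoPoleKernel]
    have h1 : 0 < ψ.re ^ 2 + (ψ.im + R) ^ 2 := by positivity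
    have h2 : 0 < ψ.re ^ 2 + (ψ.im - R) ^ 2 := by positivity
    rw [div_add_div _ _ h1.ne' h2.ne', div_eq_div_iff (by positivity) h.ne']
    have h3 : ψ.im ^ 2 = R ^ 2 - ψ.re ^ 2 := by linarith
    have e1 : ψ.re ^ 2 + (ψ.im + R) ^ 2 = 2 * R ^ 2 + 2 * R * ψ.im := by linear_combination hsq
    have e2 : ψ.re ^ 2 + (ψ.im - R) ^ 2 = 2 * R ^ 2 - 2 * R * ψ.im := by linear_combination hsq
    rw [e1, e2]
    linear_combination (4 * R ^ 2) * hsq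
  rw [this, mul_one_div, le_div_iff₀ h]
  linarith

theorem differentiableAt_twoPoleKernel (R : ℝ) {ψ : ℂ} (h : 0 < ψ.re) :
    DifferentiableAt ℂ (twoPoleKernel R) ψ := by
  have h1 : ψ + R * Complex.I ≠ 0 := fun H => by
    have := congrArg Complex.re H
    simp at this
    linarith
  have h2 : ψ - R * Complex.I ≠ 0 := fun H => by
    have := congrArg Complex.re H
    simp at this
    linarith
  unfold twoPoleKernel
  fun_prop (disch := assumption)

/-- The Cayley transform sends the disk to the right half-plane. -/
theorem re_cayley_pos {ζ w : ℂ} (hζ : ‖ζ‖ = 1) (hw : ‖w‖ < 1) : 0 < ((ζ - w) / (ζ + w)).re := by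
  have h0 : ζ + w ≠ 0 := fun H => by
    have : ζ = -w := eq_neg_of_add_eq_zero_left H
    rw [this, norm_neg] at hζ
    linarith
  have h1 : ζ.re ^ 2 + ζ.im ^ 2 = 1 := by
    have := Complex.sq_norm ζ
    rw [hζ, Complex.normSq_apply] at this
    linarith
  have h2 : w.re ^ 2 + w.im ^ 2 < 1 := by
    have := Complex.sq_norm w
    rw [Complex.normSq_apply] at this
    nlinarith [norm_nonneg w]
  have h3 : 0 < Complex.normSq (ζ + w) := Complex.normSq_pos.2 h0
  rw [Complex.div_re, ← add_div]
  apply div_pos _ h3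
  simp only [Complex.sub_re, Complex.add_re, Complex.sub_im, Complex.add_im]
  nlinarith

/-- Near the part of the circle that stays away from the truncation, a harmonic minorant is at most
a fixed proportion of the logarithmic pole. -/
theorem IsHarmonicMinorant.le_of_near_circle {Ω : Set ℂ} {h : ℂ → ℝ}
    (hh : IsHarmonicMinorant Ω 0 h) {t : ℝ} (ht : 0 < t) (ht7 : t < 1 / 7)
    (hΩ : ball (0 : ℂ) (1 - t) ⊆ Ω) {z : ℂ} (hz : ‖z‖ < 1) (hzt : 1 - 2 * t < ‖z‖)
    (hloc : ball (0 : ℂ) 1 ∩ ball z (6 * t) ⊆ Ω) :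
    h z ≤ 17 / 18 * Real.log (1 / ‖z‖) := by
  set r := ‖z‖ with hr
  set m := Real.log (1 / (1 - t)) with hm
  have hr0 : 0 < r := by linarith
  have hm0 : 0 ≤ m := Real.log_nonneg (by rw [le_div_iff₀] <;> linarith)
  have hmt : m ≤ 7 / 6 * t := by
    have h1 : m ≤ 1 / (1 - t) - 1 := Real.log_le_sub_one_of_pos (by
      apply one_div_pos.2; linarith)
    have h2 : 1 / (1 - t) - 1 ≤ 7 / 6 * t := by
      rw [sub_le_iff_le_add, div_le_iff₀ (by linarith)]
      nlinarith
    linarith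
  have hlogr : 1 - r ≤ Real.log (1 / r) := by
    rw [one_div, Real.log_inv]
    have := Real.log_le_sub_one_of_pos hr0
    linarith
  set ζ : ℂ := z / r with hζdef
  have hrC : (r : ℂ) ≠ 0 := by exact_mod_cast hr0.ne'
  have hζ : ‖ζ‖ = 1 := by
    rw [hζdef, norm_div, Complex.norm_real, Real.norm_eq_abs, abs_of_pos hr0, div_self hr0.ne']
  have hzζ : z = r * ζ := by
    rw [hζdef]
    field_simp
  have hζ0 : ζ ≠ 0 := norm_pos_iff.1 (by rw [hζ]; exact one_pos)
  set R := 2 * t with hR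
  -- The Cayley map sends `ζ` to 0, and the factor `m` makes the barrier dominate `h` on the arc.
  set Ψ : ℂ → ℝ := fun w => (((R * m : ℝ) : ℂ) * twoPoleKernel R ((ζ - w) / (ζ + w))).re with hΨ
  have hΨv : ∀ w, Ψ w = R * m * (twoPoleKernel R ((ζ - w) / (ζ + w))).re := fun w => by
    simp only [hΨ, Complex.re_ofReal_mul]
  have hne : ∀ w : ℂ, ‖w‖ < 1 → ζ + w ≠ 0 := fun w hw H => by
    rw [eq_neg_of_add_eq_zero_left H, norm_neg] at hζ
    linarith
  have hΨh : HarmonicOnNhd Ψ (ball (0 : ℂ) 1) := by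
    have hd : DifferentiableOn ℂ
        (fun w => ((R * m : ℝ) : ℂ) * twoPoleKernel R ((ζ - w) / (ζ + w))) (ball (0 : ℂ) 1) := by
      intro w hw
      rw [mem_ball_zero_iff] at hw
      have h1 : DifferentiableAt ℂ (fun w => (ζ - w) / (ζ + w)) w := by
        have := hne w hw
        fun_prop (disch := assumption)
      have h2 := DifferentiableAt.comp (g := twoPoleKernel R) w
        (differentiableAt_twoPoleKernel R (re_cayley_pos hζ hw)) h1
      exact (h2.const_mul _).differentiableWithinAt
    intro w hw
    exact (hd.analyticOnNhd isOpen_ball w hw).harmonicAt_re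
  -- `h` need not extend to the unit circle, so the region is cut at radius `1 - ε`, where the
  -- logarithm controls `h`; then `ε → 0`.
  have key : ∀ ε : ℝ, 0 < ε → ε ≤ 1 - r → h z - Ψ z ≤ Real.log (1 / (1 - ε)) := by
    intro ε hε hεr
    set K : Set ℂ := closedBall 0 (1 - ε) ∩ {w | ‖ζ - w‖ ≤ R * ‖ζ + w‖} with hKdef
    have hK : IsCompact K := (isCompact_closedBall _ _).inter_right
      (isClosed_le (by fun_prop) (by fun_prop))
    have hKn : ∀ w ∈ K, ‖w‖ < 1 := fun w hw => by
      have := mem_closedBall_zero_iff.1 hw.1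
      linarith
    have hKΩ : K ⊆ Ω := by
      intro w hw
      refine hloc ⟨mem_ball_zero_iff.2 (hKn w hw), ?_⟩
      have h1 : ‖ζ + w‖ ≤ 2 := (norm_add_le _ _).trans (by linarith [hKn w hw])
      have h2 : ‖ζ - w‖ ≤ R * ‖ζ + w‖ := hw.2
      have h3 : ‖ζ - z‖ = 1 - r := by
        have : ζ - z = ((1 - r : ℝ) : ℂ) * ζ := by rw [hzζ]; push_cast; ring
        rw [this, norm_mul, hζ, mul_one, Complex.norm_real, Real.norm_eq_abs,
          abs_of_nonneg (by linarith)]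
      have h4 : w - z = (ζ - z) - (ζ - w) := by ring
      rw [mem_ball, dist_eq_norm, h4]
      refine (norm_sub_le _ _).trans_lt ?_
      -- The distance is at most `(1 - r) + 2R < 2t + 4t = 6t`; this is what fixes `R = 2t`.
      nlinarith
    have hzK : z ∈ K := by
      refine ⟨mem_closedBall_zero_iff.2 (by linarith), ?_⟩
      have e1 : ζ - z = ((1 - r : ℝ) : ℂ) * ζ := by rw [hzζ]; push_cast; ring
      have e2 : ζ + z = ((1 + r : ℝ) : ℂ) * ζ := by rw [hzζ]; push_cast; ring
      rw [Set.mem_ofPred_eq, e1, e2, norm_mul, norm_mul, hζ, Complex.norm_real, Complex.norm_real,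
        Real.norm_eq_abs, Real.norm_eq_abs, abs_of_nonneg (by linarith),
        abs_of_nonneg (by linarith)]
      nlinarith
    refine le_of_forall_mem_frontier_le (h := fun w => h w - Ψ w) hK
      (HarmonicOnNhd.sub (hh.1.mono hKΩ)
        (hΨh.mono fun w hw => mem_ball_zero_iff.2 (hKn w hw))) ?_ hzK
    intro w hw
    have hwK : w ∈ K := hK.isClosed.frontier_subset hw
    have hwn := hKn w hwK
    have hpos := re_cayley_pos hζ hwn
    have hε1 : 0 < 1 - ε := by linarith
    rcases (mem_closedBall_zero_iff.1 hwK.1).lt_or_eq with hlt | heq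
    · have heq : ‖ζ - w‖ = R * ‖ζ + w‖ := by
        refine le_antisymm hwK.2 (not_lt.1 fun hlt' => hw.2 ?_)
        refine mem_interior.2 ⟨ball 0 (1 - ε) ∩ {w | ‖ζ - w‖ < R * ‖ζ + w‖}, ?_, ?_, ?_⟩
        · exact fun x hx => ⟨ball_subset_closedBall hx.1, le_of_lt (show ‖ζ - x‖ < R * ‖ζ + x‖ from hx.2)⟩
        · exact isOpen_ball.inter (isOpen_lt (by fun_prop) (by fun_prop))
        · exact ⟨mem_ball_zero_iff.2 hlt, hlt'⟩
      have hψ : ‖(ζ - w) / (ζ + w)‖ = R := by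
        rw [norm_div, heq, mul_div_assoc, div_self (norm_ne_zero_iff.2 (hne w hwn)), mul_one]
      have h1 := one_le_mul_re_twoPoleKernel hpos hψ
      have h2 := hh.le_log (by linarith) hΩ (hKΩ hwK)
      have h3 : 0 ≤ Real.log (1 / (1 - ε)) :=
        Real.log_nonneg (by rw [le_div_iff₀ hε1]; linarith)
      have h4 := hΨv w
      have h5 : m ≤ Ψ w := by rw [h4]; nlinarith
      linarith
    · have hw0 : w ≠ 0 := norm_pos_iff.1 (heq ▸ hε1)
      have h1 := hh.2 w (hKΩ hwK) hw0
      rw [sub_zero, heq] at h1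
      have h2 : 0 ≤ Ψ w := by
        rw [hΨv]
        exact mul_nonneg (by positivity) (re_twoPoleKernel_nonneg R hpos.le)
      linarith
  have hlim : h z - Ψ z ≤ 0 := by
    have h1 : Tendsto (fun ε : ℝ => Real.log (1 / (1 - ε))) (𝓝[>] 0) (𝓝 0) := by
      have : ContinuousAt (fun ε : ℝ => Real.log (1 / (1 - ε))) 0 := by
        fun_prop (disch := norm_num)
      have h2 := this.tendsto
      simp only [sub_zero, div_one, Real.log_one] at h2
      exact h2.mono_left nhdsWithin_le_nhds
    refine ge_of_tendsto h1 ?_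
    filter_upwards [Ioo_mem_nhdsGT (show (0 : ℝ) < 1 - r by linarith)] with ε hε
    exact key ε hε.1 hε.2.le
  have hψz : (ζ - z) / (ζ + z) = (((1 - r) / (1 + r) : ℝ) : ℂ) := by
    have e1 : ζ - z = ((1 - r : ℝ) : ℂ) * ζ := by rw [hzζ]; push_cast; ring
    have e2 : ζ + z = ((1 + r : ℝ) : ℂ) * ζ := by rw [hzζ]; push_cast; ring
    rw [e1, e2, mul_div_mul_right _ _ hζ0, Complex.ofReal_div]
  have hΨz : Ψ z ≤ 17 / 18 * (1 - r) := by
    rw [hΨv, hψz, re_twoPoleKernel]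
    simp only [Complex.ofReal_re, Complex.ofReal_im, zero_add, zero_sub, neg_sq]
    set v := (1 - r) / (1 + r) with hv
    have hv0 : 0 ≤ v := div_nonneg (by linarith) (by linarith)
    -- From `r > 1 - 2t > 5/7` follows `1 + r ≥ 12/7`.
    have hv1 : v ≤ 7 / 12 * (1 - r) := by
      rw [hv, div_le_iff₀ (by linarith)]
      nlinarith
    have hR0 : 0 < R := by positivity
    have h1 : v / (v ^ 2 + R ^ 2) ≤ v / R ^ 2 :=
      div_le_div_of_nonneg_left hv0 (by positivity) (by nlinarith)
    have h2 : R * m * (v / (v ^ 2 + R ^ 2) + v / (v ^ 2 + R ^ 2)) ≤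
        R * m * (v / R ^ 2 + v / R ^ 2) := by gcongr
    have h3 : R * m * (v / R ^ 2 + v / R ^ 2) = m * v / t := by
      rw [hR]
      field_simp
      ring
    have h4 : m * v / t ≤ 7 / 6 * v := by
      rw [div_le_iff₀ ht]
      nlinarith
    -- The product `7/6 * 7/12 = 49/72` is below `17/18`, so the constant has room to spare.
    linarith
  linarith

/-! ### Truncated disks and their Green functions -/

theorem ball_subset_truncatedDisk {E : Set ℂ} (hE : E ⊆ sphere (0 : ℂ) 1) {t : ℝ} (ht : 0 < t)
    (ht1 : t < 1) : ball (0 : ℂ) (1 - t) ⊆ truncatedDisk E t := by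
  refine (convex_ball _ _).isPreconnected.subset_connectedComponentIn
    (mem_ball_self (by linarith)) fun w hw => ?_
  rw [mem_ball_zero_iff] at hw
  refine ⟨mem_ball_zero_iff.2 (by linarith), ?_⟩
  refine lt_of_lt_of_le ((ENNReal.ofReal_lt_ofReal_iff (q := 1 - ‖w‖) (by linarith)).2
    (by linarith)) ?_
  refine le_infEDist.2 fun e he => ?_
  rw [edist_dist]
  refine ENNReal.ofReal_le_ofReal ?_
  have h1 := mem_sphere_zero_iff_norm.1 (hE he)
  have h2 := norm_sub_norm_le e w
  rw [dist_comm, dist_eq_norm]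
  linarith

theorem truncatedDisk_subset {E : Set ℂ} {t : ℝ} :
    truncatedDisk E t ⊆ {z ∈ ball (0 : ℂ) 1 | ENNReal.ofReal t < infEDist z E} :=
  connectedComponentIn_subset _ _

theorem truncatedDisk_anti {E : Set ℂ} {s t : ℝ} (hst : s ≤ t) :
    truncatedDisk E t ⊆ truncatedDisk E s :=
  connectedComponentIn_mono _ fun _ hz => ⟨hz.1, (ENNReal.ofReal_le_ofReal hst).trans_lt hz.2⟩

/-- A truncated disk contains the whole neighbourhood, within the disk, of a point far from the
truncated set. -/
theorem inter_ball_subset_truncatedDisk {E : Set ℂ} {s t : ℝ} (hs : 0 < s) (ht : 0 < t) {z : ℂ}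
    (hz : z ∈ truncatedDisk E (s + t)) : ball (0 : ℂ) 1 ∩ ball z s ⊆ truncatedDisk E t := by
  have hz' := truncatedDisk_subset hz
  have hzt := truncatedDisk_anti (E := E) (show t ≤ s + t by linarith) hz
  have heq : truncatedDisk E t =
      connectedComponentIn {z ∈ ball (0 : ℂ) 1 | ENNReal.ofReal t < infEDist z E} z :=
    connectedComponentIn_eq hzt
  rw [heq]
  refine ((convex_ball _ _).inter (convex_ball _ _)).isPreconnected.subset_connectedComponentIn
    ⟨hz'.1, mem_ball_self hs⟩ fun w hw => ⟨hw.1, ?_⟩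
  have h1 : infEDist z E ≤ infEDist w E + edist z w := by
    exact infEDist_le_infEDist_add_edist
  have h2 : edist z w < ENNReal.ofReal s := by
    rw [edist_comm, edist_dist]
    exact (ENNReal.ofReal_lt_ofReal_iff hs).2 hw.2
  have h3 := hz'.2
  rw [ENNReal.ofReal_add hs.le ht.le] at h3
  by_contra! hle
  have : infEDist w E + edist z w ≤ ENNReal.ofReal t + ENNReal.ofReal s :=
    add_le_add hle h2.le
  rw [add_comm (ENNReal.ofReal t)] at this
  exact absurd (h3.trans_le (h1.trans this)) (lt_irrefl _)

theorem IsHarmonicMinorant.le_of_mem_truncatedDisk {E : Set ℂ} (hE : E ⊆ sphere (0 : ℂ) 1) {t : ℝ}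
    (ht : 0 < t) (ht7 : t < 1 / 7) {z : ℂ} (hz : z ∈ truncatedDisk E (7 * t)) (hz0 : z ≠ 0)
    {h : ℂ → ℝ} (hh : IsHarmonicMinorant (truncatedDisk E t) 0 h) :
    h z ≤ 17 / 18 * Real.log (1 / ‖z‖) := by
  have hΩ := ball_subset_truncatedDisk hE ht (by linarith)
  have hz1 : ‖z‖ < 1 := mem_ball_zero_iff.1 (truncatedDisk_subset hz).1
  rcases lt_or_ge (1 - 2 * t) ‖z‖ with hzt | hzt
  · refine hh.le_of_near_circle ht ht7 hΩ hz1 hzt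
      (inter_ball_subset_truncatedDisk (by positivity) ht ?_)
    convert hz using 2
    ring
  · have hr0 : 0 < ‖z‖ := norm_pos_iff.2 hz0
    have h1 := hh.le_log (by linarith) hΩ (truncatedDisk_anti (by linarith) hz)
    have h2 : 2 * Real.log (1 / (1 - t)) ≤ Real.log (1 / ‖z‖) := by
      rw [one_div, one_div, Real.log_inv, Real.log_inv]
      -- Here `‖z‖ ≤ 1 - 2t ≤ (1 - t)^2`.
      have : Real.log ‖z‖ ≤ Real.log ((1 - t) ^ 2) := Real.log_le_log hr0 (by nlinarith)
      rw [Real.log_pow] at this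
      push_cast at this
      linarith
    have h3 : 0 ≤ Real.log (1 / ‖z‖) := Real.log_nonneg (by rw [le_div_iff₀ hr0]; linarith)
    linarith

theorem diskGreen_zero {z : ℂ} (hz : z ≠ 0) :
    diskGreen z 0 = ENNReal.ofReal (Real.log (1 / ‖z‖)) := by
  simp [diskGreen, hz]

theorem isHarmonicMinorant_zero {Ω : Set ℂ} (hΩ : Ω ⊆ ball (0 : ℂ) 1) :
    IsHarmonicMinorant Ω 0 fun _ => 0 := by
  refine ⟨harmonicOnNhd_const 0, fun z hz hz0 => Real.log_nonneg ?_⟩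
  rw [sub_zero, le_div_iff₀ (norm_pos_iff.2 hz0)]
  linarith [mem_ball_zero_iff.1 (hΩ hz)]

theorem domainGreen_le_diskGreen {Ω : Set ℂ} (hΩ : Ω ⊆ ball (0 : ℂ) 1) {z : ℂ} (hz : z ∈ Ω) :
    domainGreen Ω z 0 ≤ diskGreen z 0 := by
  rcases eq_or_ne z 0 with rfl | hz0
  · simp [diskGreen]
  rw [diskGreen_zero hz0, domainGreen, if_neg hz0]
  refine ENNReal.ofReal_le_ofReal ?_
  have : 0 ≤ sSup {s : ℝ | ∃ h : ℂ → ℝ, IsHarmonicMinorant Ω 0 h ∧ s = h z} := by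
    refine le_csSup ⟨Real.log (1 / ‖z - 0‖), ?_⟩ ⟨_, isHarmonicMinorant_zero hΩ, rfl⟩
    rintro _ ⟨h, hh, rfl⟩
    exact hh.2 z hz hz0
  rw [sub_zero]
  linarith

theorem diskGreen_le_domainGreen_truncatedDisk {E : Set ℂ} (hE : E ⊆ sphere (0 : ℂ) 1) {t : ℝ}
    (ht : 0 < t) (ht7 : t < 1 / 7) {z : ℂ} (hz : z ∈ truncatedDisk E (7 * t)) :
    1 / 18 * diskGreen z 0 ≤ domainGreen (truncatedDisk E t) z 0 := by
  rcases eq_or_ne z 0 with rfl | hz0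
  · simp [domainGreen]
  have h18 : (1 / 18 : ℝ≥0∞) = ENNReal.ofReal (1 / 18) := by
    rw [ENNReal.ofReal_div_of_pos (by norm_num)]
    simp
  rw [diskGreen_zero hz0, domainGreen, if_neg hz0, h18, ← ENNReal.ofReal_mul (by norm_num)]
  refine ENNReal.ofReal_le_ofReal ?_
  have : sSup {s : ℝ | ∃ h : ℂ → ℝ, IsHarmonicMinorant (truncatedDisk E t) 0 h ∧ s = h z} ≤
      17 / 18 * Real.log (1 / ‖z‖) := by
    -- The zero minorant supplies the nonemptiness needed to bound the supremum.
    refine csSup_le ⟨_, _, isHarmonicMinorant_zero fun w hw => (truncatedDisk_subset hw).1, rfl⟩ ?_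
    rintro _ ⟨h, hh, rfl⟩
    exact hh.le_of_mem_truncatedDisk hE ht ht7 hz hz0
  rw [sub_zero]
  linarith

/-- Test the distance at `z/‖z‖` and use `1 - r ≤ log (1/r)`. -/
theorem infEDist_sphere_le_diskGreen {z : ℂ} (hz : ‖z‖ < 1) :
    infEDist z (sphere (0 : ℂ) 1) ≤ diskGreen z 0 := by
  rcases eq_or_ne z 0 with rfl | hz0
  · simp [diskGreen]
  have hr0 : 0 < ‖z‖ := norm_pos_iff.2 hz0
  have hmem : ((‖z‖⁻¹ : ℝ) : ℂ) * z ∈ sphere (0 : ℂ) 1 := by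
    rw [mem_sphere_zero_iff_norm, norm_mul, Complex.norm_real, Real.norm_eq_abs,
      abs_of_pos (inv_pos.2 hr0), inv_mul_cancel₀ hr0.ne']
  refine (infEDist_le_edist_of_mem hmem).trans ?_
  rw [diskGreen_zero hz0, edist_dist, dist_eq_norm]
  refine ENNReal.ofReal_le_ofReal ?_
  have e : z - ((‖z‖⁻¹ : ℝ) : ℂ) * z = ((1 - ‖z‖⁻¹ : ℝ) : ℂ) * z := by
    push_cast
    ring
  have h1 : 1 ≤ ‖z‖⁻¹ := (one_le_inv₀ hr0).2 hz.le
  rw [e, norm_mul, Complex.norm_real, Real.norm_eq_abs, abs_of_nonpos (by linarith), one_div,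
    Real.log_inv, neg_sub, sub_mul, inv_mul_cancel₀ hr0.ne']
  linarith [Real.log_le_sub_one_of_pos hr0]

end DiskTree

namespace DiskTree

open SimpleGraph

/-! ### Parents, children, ends and truncated trees -/

section TreeGeometry

variable {V : Type*} {G : SimpleGraph V}

theorem length_eq_dist_of_isPath (hG : G.IsTree) {u v : V} {p : G.Walk u v} (hp : p.IsPath) :
    p.length = G.dist u v := by
  obtain ⟨p', hp', hl⟩ := hG.connected.exists_path_of_dist u v
  rw [← hl, (hG.existsUnique_path u v).unique hp hp']

theorem dist_le_of_mem_support {u v w : V} {p : G.Walk u v} (hw : w ∈ p.support) :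
    G.dist u w ≤ p.length := by
  classical
  exact (dist_le (p.takeUntil w hw)).trans (p.length_takeUntil_le_length hw)

/-- Every path in a tree to a child passes through the parent. -/
theorem exists_path_concat (hG : G.IsTree) {o x y : V} (hxy : G.Adj x y)
    (hd : G.dist o y = G.dist o x + 1) {p : G.Walk o y} (hp : p.IsPath) :
    ∃ p' : G.Walk o x, p'.IsPath ∧ p = p'.concat hxy := by
  obtain ⟨p', hp', hl⟩ := hG.connected.exists_path_of_dist o x
  refine ⟨p', hp', (hG.existsUnique_path o y).unique hp ?_⟩
  exact Walk.isPath_of_length_eq_dist _ (by rw [Walk.length_concat, hl, hd])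

theorem eq_of_adj_of_dist_eq_add_one (hG : G.IsTree) {o x x' y : V} (hx : G.Adj x y)
    (hd : G.dist o y = G.dist o x + 1) (hx' : G.Adj x' y) (hd' : G.dist o y = G.dist o x' + 1) :
    x = x' := by
  obtain ⟨p, hp, -⟩ := hG.existsUnique_path o y
  obtain ⟨p₁, -, h₁⟩ := exists_path_concat hG hx hd hp
  obtain ⟨p₂, -, h₂⟩ := exists_path_concat hG hx' hd' hp
  exact (Walk.concat_inj (h₁.symm.trans h₂)).1

theorem exists_adj_dist_eq_add_one (hG : G.IsTree) {o y : V} (hy : G.dist o y ≠ 0) :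
    ∃ x, G.Adj x y ∧ G.dist o y = G.dist o x + 1 := by
  obtain ⟨p, hp, hl⟩ := hG.connected.exists_path_of_dist o y
  have hnil : ¬ p.Nil := fun h => hy (by rw [← hl, Walk.length_eq_zero_iff.2 h])
  refine ⟨p.penultimate, p.adj_penultimate hnil, ?_⟩
  have h1 : G.dist o p.penultimate ≤ p.length - 1 :=
    (dist_le p.dropLast).trans (by simp)
  have h2 := hG.dist_eq_dist_add_one_of_adj o (p.adj_penultimate hnil)
  omega

theorem sum_neighborFinset_dist_root [G.LocallyFinite] {M : Type*} [AddCommMonoid M]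
    (F : ℕ → M) (o : V) :
    ∑ z ∈ G.neighborFinset o, F (G.dist o z) = G.degree o • F 1 := by
  rw [← G.card_neighborFinset_eq_degree, ← Finset.sum_const]
  refine Finset.sum_congr rfl fun z hz => ?_
  rw [dist_eq_one_iff_adj.2 ((G.mem_neighborFinset _ _).1 hz)]

theorem sum_neighborFinset_dist [G.LocallyFinite] (hG : G.IsTree) {M : Type*} [AddCommMonoid M]
    (F : ℕ → M) {o x : V} {d : ℕ} (hd : G.dist o x = d + 1) :
    ∑ z ∈ G.neighborFinset x, F (G.dist o z) = F d + (G.degree x - 1) • F (d + 2) := by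
  classical
  obtain ⟨p, hp, hpd⟩ := exists_adj_dist_eq_add_one hG (o := o) (y := x) (by omega)
  have hpm : p ∈ G.neighborFinset x := (G.mem_neighborFinset _ _).2 hp.symm
  rw [← Finset.add_sum_erase _ _ hpm, show G.dist o p = d by omega,
    ← G.card_neighborFinset_eq_degree, ← Finset.card_erase_of_mem hpm, ← Finset.sum_const]
  congr 1
  refine Finset.sum_congr rfl fun z hz => ?_
  obtain ⟨hzp, hz⟩ := Finset.mem_erase.1 hz
  have hadj := (G.mem_neighborFinset _ _).1 hz
  rcases hG.dist_eq_dist_add_one_of_adj o hadj with h | h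
  · exact absurd (eq_of_adj_of_dist_eq_add_one hG hadj.symm h hp hpd) hzp
  · rw [h, hd]

/-- A ray that turned back towards its start would have to step to the unique parent, which it has
just left; injectivity forbids this. -/
theorem dist_ray (hG : G.IsTree) (r : Ray G) (n : ℕ) : G.dist (r.vert 0) (r.vert n) = n := by
  suffices h : ∀ n, G.dist (r.vert 0) (r.vert n) = n ∧
      G.dist (r.vert 0) (r.vert (n + 1)) = n + 1 from (h n).1
  intro n
  induction n with
  | zero => exact ⟨dist_self, by simpa using dist_eq_one_iff_adj.2 (r.adj 0)⟩
  | succ n ih =>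
    refine ⟨ih.2, ?_⟩
    rcases hG.dist_eq_dist_add_one_of_adj (r.vert 0) (r.adj (n + 1)) with h | h
    · have h1 := r.inj (eq_of_adj_of_dist_eq_add_one hG (r.adj n)
        (by omega) (r.adj (n + 1)).symm h)
      omega
    · omega

theorem dist_le_of_mem_rootGeodesic (hG : G.IsTree) {o x v : V}
    (hv : v ∈ rootGeodesic G o (Sum.inl x)) : G.dist o v ≤ G.dist o x := by
  obtain ⟨p, hp, hvp⟩ := hv
  exact (dist_le_of_mem_support hvp).trans_eq (length_eq_dist_of_isPath hG hp)

theorem dist_mem_upperBounds (hG : G.IsTree) (o x : V) (ξ : V ⊕ Ends G) :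
    G.dist o x ∈ upperBounds
      (G.dist o '' (rootGeodesic G o (Sum.inl x) ∩ rootGeodesic G o ξ)) := by
  rintro _ ⟨v, hv, rfl⟩
  exact dist_le_of_mem_rootGeodesic hG hv.1

theorem confluentLength_le_dist (hG : G.IsTree) (o x : V) (ξ : V ⊕ Ends G) :
    confluentLength G o (Sum.inl x) ξ ≤ G.dist o x :=
  csSup_le' (dist_mem_upperBounds hG o x ξ)

theorem dist_le_confluentLength (hG : G.IsTree) {o x : V} {ξ : V ⊕ Ends G}
    (hx : x ∈ rootGeodesic G o ξ) : G.dist o x ≤ confluentLength G o (Sum.inl x) ξ := by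
  obtain ⟨p, hp, -⟩ := hG.existsUnique_path o x
  exact le_csSup ⟨_, dist_mem_upperBounds hG o x ξ⟩ ⟨x, ⟨⟨p, hp, p.end_mem_support⟩, hx⟩, rfl⟩

theorem rootGeodesic_child (hG : G.IsTree) {o x y : V} (hxy : G.Adj x y)
    (hd : G.dist o y = G.dist o x + 1) :
    rootGeodesic G o (Sum.inl y) ⊆ insert y (rootGeodesic G o (Sum.inl x)) := by
  rintro v ⟨p, hp, hv⟩
  obtain ⟨p', hp', rfl⟩ := exists_path_concat hG hxy hd hp
  rw [Walk.support_concat, List.mem_append, List.mem_singleton] at hv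
  exact hv.elim (fun h => Or.inr ⟨p', hp', h⟩) Or.inl

theorem mem_rootGeodesic_end_of_child (hG : G.IsTree) {o x y : V} (hxy : G.Adj x y)
    (hd : G.dist o y = G.dist o x + 1) {ξ : Ends G} (hy : y ∈ rootGeodesic G o (Sum.inr ξ)) :
    x ∈ rootGeodesic G o (Sum.inr ξ) := by
  obtain ⟨r, hr, rfl, n, rfl⟩ := hy
  rw [dist_ray hG] at hd
  subst hd
  refine ⟨r, hr, rfl, G.dist (r.vert 0) x, ?_⟩
  exact eq_of_adj_of_dist_eq_add_one (o := r.vert 0) hG (r.adj _)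
    (by rw [dist_ray hG, dist_ray hG]) hxy (by rw [dist_ray hG])

/-- The root geodesic to `y` adds only `y` to that of `x`, and `y` is not on the geodesic to `ξ`, so
no new common vertex appears. -/
theorem confluentLength_child_le (hG : G.IsTree) {o x y : V} (hxy : G.Adj x y)
    (hd : G.dist o y = G.dist o x + 1) {ξ : V ⊕ Ends G} (hy : y ∉ rootGeodesic G o ξ) :
    confluentLength G o (Sum.inl y) ξ ≤ confluentLength G o (Sum.inl x) ξ := by
  refine csSup_le_csSup' ⟨_, dist_mem_upperBounds hG o x ξ⟩ (Set.image_mono ?_)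
  rintro v ⟨hvy, hvξ⟩
  rcases rootGeodesic_child hG hxy hd hvy with rfl | hvx
  · exact absurd hvξ hy
  · exact ⟨hvx, hvξ⟩

theorem lengthMetric_vertex_end (q : ℕ) (o x : V) (ξ : Ends G) :
    lengthMetric G q o (Sum.inl x) (Sum.inr ξ) =
      ((q : ℝ) ^ confluentLength G o (Sum.inl x) (Sum.inr ξ))⁻¹ := by
  simp [lengthMetric]

theorem inv_pow_anti {q : ℕ} (hq : 1 ≤ q) {m n : ℕ} (h : m ≤ n) :
    ((q : ℝ) ^ n)⁻¹ ≤ ((q : ℝ) ^ m)⁻¹ := by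
  have : (1 : ℝ) ≤ q := by exact_mod_cast hq
  exact inv_anti₀ (by positivity) (pow_le_pow_right₀ this h)

theorem ofReal_le_distToEnds (hG : G.IsTree) {q : ℕ} (hq : 1 ≤ q) (o x : V) (E : Set (Ends G)) :
    ENNReal.ofReal ((q : ℝ) ^ G.dist o x)⁻¹ ≤ distToEnds G q o x E := by
  refine le_iInf₂ fun ξ _ => ENNReal.ofReal_le_ofReal ?_
  rw [lengthMetric_vertex_end]
  exact inv_pow_anti hq (confluentLength_le_dist hG o x _)

theorem distToEnds_le_of_mem_rootGeodesic (hG : G.IsTree) {q : ℕ} (hq : 1 ≤ q) {o x : V}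
    {E : Set (Ends G)} {ξ : Ends G} (hξ : ξ ∈ E) (hx : x ∈ rootGeodesic G o (Sum.inr ξ)) :
    distToEnds G q o x E ≤ ENNReal.ofReal ((q : ℝ) ^ G.dist o x)⁻¹ := by
  refine (iInf₂_le ξ hξ).trans (ENNReal.ofReal_le_ofReal ?_)
  rw [lengthMetric_vertex_end]
  exact inv_pow_anti hq (dist_le_confluentLength hG hx)

/-- The strict inequality `hx` says that no end of `E` lies beyond `x`. Then none lies beyond the
child `y`, and moving to `y` lengthens no confluent. -/
theorem distToEnds_le_child (hG : G.IsTree) {q : ℕ} (hq : 1 ≤ q) {o x y : V} {E : Set (Ends G)}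
    (hxy : G.Adj x y) (hd : G.dist o y = G.dist o x + 1)
    (hx : ENNReal.ofReal ((q : ℝ) ^ G.dist o x)⁻¹ < distToEnds G q o x E) :
    distToEnds G q o x E ≤ distToEnds G q o y E := by
  refine le_iInf₂ fun ξ hξ => (iInf₂_le ξ hξ).trans (ENNReal.ofReal_le_ofReal ?_)
  rw [lengthMetric_vertex_end, lengthMetric_vertex_end]
  refine inv_pow_anti hq (confluentLength_child_le hG hxy hd fun hy => ?_)
  exact absurd (distToEnds_le_of_mem_rootGeodesic hG hq hξ
    (mem_rootGeodesic_end_of_child hG hxy hd hy)) (not_le.2 hx)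

theorem lt_distToEnds_of_mem_truncatedTree {q : ℕ} {o x : V} {E : Set (Ends G)} {t : ℝ}
    (hx : x ∈ truncatedTree G q o E t) : ENNReal.ofReal t < distToEnds G q o x E := by
  obtain ⟨p, hp⟩ := hx
  exact hp x p.end_mem_support

theorem mem_truncatedTree_of_lt (hG : G.IsTree) {q : ℕ} (hq : 1 ≤ q) {o x : V} {E : Set (Ends G)}
    {t : ℝ} (hx : t < ((q : ℝ) ^ G.dist o x)⁻¹) : x ∈ truncatedTree G q o E t := by
  obtain ⟨p, hp, hl⟩ := hG.connected.exists_path_of_dist o x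
  have hq0 : (0 : ℝ) < q := by exact_mod_cast hq
  refine ⟨p, fun y hy => lt_of_lt_of_le ?_ (ofReal_le_distToEnds hG hq o y E)⟩
  refine (ENNReal.ofReal_lt_ofReal_iff (by positivity)).2 (hx.trans_le (inv_pow_anti hq ?_))
  exact (dist_le_of_mem_support hy).trans_eq hl

theorem mem_truncatedTree_parent (hG : G.IsTree) {q : ℕ} {o x y : V} {E : Set (Ends G)} {t : ℝ}
    (hy : y ∈ truncatedTree G q o E t) (hxy : G.Adj x y) (hd : G.dist o y = G.dist o x + 1) :
    x ∈ truncatedTree G q o E t := by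
  classical
  obtain ⟨p, hp⟩ := hy
  obtain ⟨p', -, h⟩ := exists_path_concat hG hxy hd p.bypass_isPath
  refine ⟨p', fun v hv => hp v (p.support_bypass_subset_support ?_)⟩
  rw [h]
  exact p'.support_subset_support_concat hxy hv

/-- Past the level where `q^(-d) ≤ t`, a vertex can survive only if no end of `E` lies beyond it, so
its whole subtree survives. -/
theorem mem_truncatedTree_child (hG : G.IsTree) {q : ℕ} (hq : 1 ≤ q) {o x y : V}
    {E : Set (Ends G)} {t : ℝ} (hx : x ∈ truncatedTree G q o E t) (hxy : G.Adj x y)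
    (hd : G.dist o y = G.dist o x + 1) (ht : ((q : ℝ) ^ G.dist o x)⁻¹ ≤ t) :
    y ∈ truncatedTree G q o E t := by
  have hx' := lt_distToEnds_of_mem_truncatedTree hx
  have hle := distToEnds_le_child hG hq hxy hd
    ((ENNReal.ofReal_le_ofReal ht).trans_lt hx')
  obtain ⟨p, hp⟩ := hx
  refine ⟨p.concat hxy, fun v hv => ?_⟩
  rw [Walk.support_concat, List.mem_append, List.mem_singleton] at hv
  rcases hv with hv | rfl
  · exact hp v hv
  · exact hx'.trans_le hle

theorem exists_child [G.LocallyFinite] (hG : G.IsTree) (o x : V) (hx : 2 ≤ G.degree x) :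
    ∃ y, G.Adj x y ∧ G.dist o y = G.dist o x + 1 := by
  obtain ⟨a, b, ha, hb, hab⟩ := Finset.one_lt_card_iff.1
    (show 1 < (G.neighborFinset x).card by rw [G.card_neighborFinset_eq_degree]; omega)
  rw [G.mem_neighborFinset] at ha hb
  rcases hG.dist_eq_dist_add_one_of_adj o ha with h | h
  · rcases hG.dist_eq_dist_add_one_of_adj o hb with h' | h'
    · exact absurd (eq_of_adj_of_dist_eq_add_one hG ha.symm h hb.symm h') hab
    · exact ⟨b, hb, h'⟩
  · exact ⟨a, ha, h⟩

theorem exists_end_of_vertex [G.LocallyFinite] (hG : G.IsTree) (hdeg : ∀ x, 2 ≤ G.degree x)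
    (o x : V) : ∃ ξ : Ends G, x ∈ rootGeodesic G o (Sum.inr ξ) := by
  choose c hc hcd using fun y => exists_child hG o y (hdeg y)
  obtain ⟨p, hp, hl⟩ := hG.connected.exists_path_of_dist o x
  have hdist : ∀ n, G.dist o (c^[n - p.length] (p.getVert n)) = n := by
    intro n
    rcases le_total n p.length with h | h
    · rw [Nat.sub_eq_zero_of_le h, Function.iterate_zero, id]
      have h1 : G.dist o (p.getVert n) ≤ n := (dist_le (p.take n)).trans (by simp)
      have h2 : G.dist (p.getVert n) x ≤ p.length - n := (dist_le (p.drop n)).trans (by simp)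
      have h3 := hG.connected.dist_triangle (u := o) (v := p.getVert n) (w := x)
      omega
    · rw [p.getVert_of_length_le h]
      have : ∀ k, G.dist o (c^[k] x) = p.length + k := fun k => by
        induction k with
        | zero => simp [hl]
        | succ k ih => rw [Function.iterate_succ_apply', hcd, ih, add_assoc]
      rw [this]
      omega
  -- Truncated subtraction glues two pieces: up to `p.length` no iterate is applied and the ray
  -- follows `p`; afterwards `getVert` stays at `x` and the iterates of `c` descend. Distance `n` at
  -- time `n` gives injectivity.
  let r : Ray G :=
    { vert := fun n => c^[n - p.length] (p.getVert n)
      adj := fun n => by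
        rcases lt_or_ge n p.length with h | h
        · rw [Nat.sub_eq_zero_of_le h.le, Nat.sub_eq_zero_of_le h]
          exact p.adj_getVert_succ h
        · rw [p.getVert_of_length_le h, p.getVert_of_length_le (h.trans n.le_succ),
            Nat.sub_add_comm h, Function.iterate_succ_apply']
          exact hc _
      inj := fun a b hab => by
        have := congrArg (G.dist o) hab
        simpa only [hdist] using this }
  refine ⟨Quotient.mk _ r, r, rfl, ?_, p.length, ?_⟩
  · simp [r]
  · simp [r]

theorem distToEnds_univ_le [G.LocallyFinite] (hG : G.IsTree) (hdeg : ∀ x, 2 ≤ G.degree x) {q : ℕ}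
    (hq : 1 ≤ q) (o x : V) :
    distToEnds G q o x Set.univ ≤ ENNReal.ofReal ((q : ℝ) ^ G.dist o x)⁻¹ := by
  obtain ⟨ξ, hξ⟩ := exists_end_of_vertex hG hdeg o x
  exact distToEnds_le_of_mem_rootGeodesic hG hq (Set.mem_univ ξ) hξ

theorem treeGreen_eq (q : ℕ) (o x : V) : treeGreen G q x o =
    ENNReal.ofReal ((q : ℝ) / (q - 1) * ((q : ℝ) ^ G.dist o x)⁻¹) := by
  rw [treeGreen, dist_comm]

theorem inv_mul_treeGreen {q : ℕ} (hq : 2 ≤ q) (o x : V) :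
    (ENNReal.ofReal ((q : ℝ) / (q - 1)))⁻¹ * treeGreen G q x o =
      ENNReal.ofReal ((q : ℝ) ^ G.dist o x)⁻¹ := by
  have h2 : (2 : ℝ) ≤ q := by exact_mod_cast hq
  have h : 0 < (q : ℝ) / (q - 1) := div_pos (by linarith) (by linarith)
  rw [treeGreen_eq, ENNReal.ofReal_mul h.le, ← mul_assoc,
    ENNReal.inv_mul_cancel (ENNReal.ofReal_pos.2 h).ne' ENNReal.ofReal_ne_top, one_mul]

end TreeGeometry

end DiskTree

namespace DiskTree

open SimpleGraph Filter Topology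

/-! ### Comparison principles for the killed random walk -/

section Comparison

variable {V : Type*} {G : SimpleGraph V} [G.LocallyFinite]

/-- First-step decomposition of the truncated Green function, the recursion behind both comparison
inductions. -/
theorem sum_range_succ_killedWalkProb (A : Set V) [DecidablePred (· ∈ A)] [DecidableEq V] (x y : V)
    (N : ℕ) : ∑ n ∈ Finset.range (N + 1), killedWalkProb G A y n x =
      if x ∈ A then (if x = y then 1 else 0) + ∑ z ∈ G.neighborFinset x,
        (G.degree x : ℝ≥0∞)⁻¹ * ∑ n ∈ Finset.range N, killedWalkProb G A y n z
      else 0 := by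
  rw [Finset.sum_range_succ']
  by_cases hx : x ∈ A
  · simp only [killedWalkProb, hx, if_true, true_and]
    rw [Finset.sum_comm, add_comm]
    simp only [Finset.mul_sum]
  · simp [killedWalkProb, hx]

theorem ofReal_inv_degree {x : V} (hx : 0 < G.degree x) :
    ENNReal.ofReal (G.degree x : ℝ)⁻¹ = (G.degree x : ℝ≥0∞)⁻¹ := by
  rw [ENNReal.ofReal_inv_of_pos (by exact_mod_cast hx), ENNReal.ofReal_natCast]

/-- Only an inequality, since a subsolution may be negative and `ENNReal.ofReal` truncates. -/
theorem ofReal_average_le {x : V} (hx : 0 < G.degree x) (f : V → ℝ) :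
    ENNReal.ofReal ((G.degree x : ℝ)⁻¹ * ∑ z ∈ G.neighborFinset x, f z) ≤
      ∑ z ∈ G.neighborFinset x, (G.degree x : ℝ≥0∞)⁻¹ * ENNReal.ofReal (f z) := by
  rw [ENNReal.ofReal_mul (by positivity), ofReal_inv_degree hx, ← Finset.mul_sum]
  gcongr
  exact Finset.le_sum_of_subadditive _ (by simp) (fun _ _ => ENNReal.ofReal_add_le) _ _

theorem ofReal_average {x : V} (hx : 0 < G.degree x) {f : V → ℝ} (hf : ∀ z, 0 ≤ f z) :
    ENNReal.ofReal ((G.degree x : ℝ)⁻¹ * ∑ z ∈ G.neighborFinset x, f z) =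
      ∑ z ∈ G.neighborFinset x, (G.degree x : ℝ≥0∞)⁻¹ * ENNReal.ofReal (f z) := by
  rw [ENNReal.ofReal_mul (by positivity), ofReal_inv_degree hx, ← Finset.mul_sum,
    ENNReal.ofReal_sum_of_nonneg fun z _ => hf z]

/-- The Green function is at most every nonnegative supersolution of the Poisson equation. -/
theorem subsetGreen_le_ofReal [DecidableEq V] (hdeg : ∀ x, 0 < G.degree x) (A : Set V) (y : V)
    {u : V → ℝ} (hu : ∀ x, 0 ≤ u x)
    (hsup : ∀ x, (if x = y then 1 else 0) +
      (G.degree x : ℝ)⁻¹ * ∑ z ∈ G.neighborFinset x, u z ≤ u x) (x : V) :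
    subsetGreen G A x y ≤ ENNReal.ofReal (u x) := by
  classical
  refine ENNReal.tsum_le_of_sum_range_le fun N => ?_
  induction N generalizing x with
  | zero => simp
  | succ N ih =>
    rw [sum_range_succ_killedWalkProb]
    split_ifs with hx hxy
    · refine le_trans ?_ (ENNReal.ofReal_le_ofReal (hsup x))
      rw [if_pos hxy, ENNReal.ofReal_add zero_le_one
        (mul_nonneg (by positivity) (Finset.sum_nonneg fun z _ => hu z)),
        ofReal_average (hdeg x) hu, ENNReal.ofReal_one]
      gcongr with z hz
      exact ih z
    · refine le_trans ?_ (ENNReal.ofReal_le_ofReal (hsup x))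
      rw [if_neg hxy, zero_add, zero_add, ofReal_average (hdeg x) hu]
      gcongr with z hz
      exact ih z
    · exact zero_le

/-- A subsolution of the Poisson equation that is nonpositive off `A`, and is dominated by a function
that the random walk contracts, is at most the Green function of `A`. -/
theorem ofReal_le_subsetGreen [DecidableEq V] (hdeg : ∀ x, 0 < G.degree x) {A : Set V} (y : V)
    {f r : V → ℝ} {c : ℝ} (hc0 : 0 ≤ c) (hc1 : c < 1) (hA : ∀ x ∉ A, f x ≤ 0)
    (hsub : ∀ x ∈ A, f x ≤ (if x = y then 1 else 0) +
      (G.degree x : ℝ)⁻¹ * ∑ z ∈ G.neighborFinset x, f z)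
    (hr0 : ∀ x, 0 ≤ r x) (hfr : ∀ x, f x ≤ r x)
    (hr : ∀ x, (G.degree x : ℝ)⁻¹ * ∑ z ∈ G.neighborFinset x, r z ≤ c * r x) (x : V) :
    ENNReal.ofReal (f x) ≤ subsetGreen G A x y := by
  classical
  have key : ∀ N x, ENNReal.ofReal (f x) ≤
      ∑ n ∈ Finset.range N, killedWalkProb G A y n x + ENNReal.ofReal (c ^ N * r x) := by
    intro N
    induction N with
    | zero => exact fun x => by simpa using ENNReal.ofReal_le_ofReal (hfr x)
    | succ N ih =>
      intro x
      by_cases hx : x ∈ A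
      · rw [sum_range_succ_killedWalkProb, if_pos hx]
        have h1 : ENNReal.ofReal (if x = y then (1 : ℝ) else 0) = if x = y then 1 else 0 := by
          split_ifs <;> simp
        calc ENNReal.ofReal (f x)
            ≤ (if x = y then 1 else 0) + ∑ z ∈ G.neighborFinset x,
                (G.degree x : ℝ≥0∞)⁻¹ * ENNReal.ofReal (f z) := by
              refine (ENNReal.ofReal_le_ofReal (hsub x hx)).trans ?_
              refine ENNReal.ofReal_add_le.trans ?_
              rw [h1]
              gcongr
              exact ofReal_average_le (hdeg x) f
          _ ≤ (if x = y then 1 else 0) + ∑ z ∈ G.neighborFinset x, (G.degree x : ℝ≥0∞)⁻¹ *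
                (∑ n ∈ Finset.range N, killedWalkProb G A y n z +
                  ENNReal.ofReal (c ^ N * r z)) := by
              gcongr with z hz
              exact ih z
          _ ≤ _ := by
              simp only [mul_add, Finset.sum_add_distrib]
              rw [← add_assoc, ← ofReal_average (hdeg x)
                (fun z => mul_nonneg (pow_nonneg hc0 N) (hr0 z))]
              have h2 : (G.degree x : ℝ)⁻¹ * ∑ z ∈ G.neighborFinset x, c ^ N * r z ≤
                  c ^ (N + 1) * r x := by
                rw [← Finset.mul_sum, mul_left_comm, pow_succ, mul_assoc]
                exact mul_le_mul_of_nonneg_left (hr x) (pow_nonneg hc0 N)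
              gcongr
      · rw [ENNReal.ofReal_of_nonpos (hA x hx)]
        exact zero_le
  have hlim : Tendsto (fun N : ℕ => subsetGreen G A x y + ENNReal.ofReal (c ^ N * r x)) atTop
      (𝓝 (subsetGreen G A x y)) := by
    have h1 : Tendsto (fun N : ℕ => c ^ N * r x) atTop (𝓝 0) := by
      simpa using (tendsto_pow_atTop_nhds_zero_of_lt_one hc0 hc1).mul_const (r x)
    simpa using (ENNReal.tendsto_ofReal h1).const_add (subsetGreen G A x y)
  refine ge_of_tendsto' hlim fun N => (key N x).trans ?_
  gcongr
  exact ENNReal.sum_le_tsum _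

end Comparison

end DiskTree

namespace DiskTree

open SimpleGraph

/-! ### Radial functions and the subsolution on the regular tree -/

section RegularTree

variable {V : Type*} {G : SimpleGraph V} [G.LocallyFinite]

/-- The average over the neighbours of a radial function on the tree of degree `q + 1`. -/
noncomputable def radialMean (q : ℕ) (F : ℕ → ℝ) : ℕ → ℝ
  | 0 => F 1
  | d + 1 => (F d + q * F (d + 2)) / (q + 1)

theorem average_radial (hG : G.IsTree) {q : ℕ} (hreg : G.IsRegularOfDegree (q + 1)) (o x : V)
    (F : ℕ → ℝ) : (G.degree x : ℝ)⁻¹ * ∑ z ∈ G.neighborFinset x, F (G.dist o z) =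
      radialMean q F (G.dist o x) := by
  have hq : (q : ℝ) + 1 ≠ 0 := by positivity
  rcases hd : G.dist o x with _ | d
  · rw [hG.connected.dist_eq_zero_iff] at hd
    subst hd
    rw [sum_neighborFinset_dist_root, hreg o, nsmul_eq_mul, radialMean]
    push_cast
    field_simp
  · rw [sum_neighborFinset_dist hG F hd, hreg x, nsmul_eq_mul, radialMean]
    push_cast
    field_simp

/-- Averaging preserves constants, so subtracting `b` costs nothing; this covers the full Green
function (`b = 0`) and that of a ball. -/
theorem radialMean_green {q : ℕ} (hq : 2 ≤ q) (b : ℝ) (d : ℕ) :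
    (if d = 0 then 1 else 0) +
      radialMean q (fun n => (q : ℝ) / (q - 1) * ((q : ℝ) ^ n)⁻¹ - b) d =
      (q : ℝ) / (q - 1) * ((q : ℝ) ^ d)⁻¹ - b := by
  have h2 : (2 : ℝ) ≤ q := by exact_mod_cast hq
  have h1 : (q : ℝ) - 1 ≠ 0 := by linarith
  have h0 : (q : ℝ) ≠ 0 := by linarith
  have h3 : (q : ℝ) + 1 ≠ 0 := by linarith
  rcases d with _ | d
  · simp only [radialMean, if_true, pow_one, pow_zero, inv_one, mul_one]
    field_simp
    ring
  · simp only [radialMean, Nat.add_eq_zero_iff, one_ne_zero, and_false, if_false, pow_succ]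
    field_simp
    ring

theorem radialMean_inv_pow {q : ℕ} (hq : 1 ≤ q) {d : ℕ} (hd : d ≠ 0) :
    radialMean q (fun n => ((q : ℝ) ^ n)⁻¹) d = ((q : ℝ) ^ d)⁻¹ := by
  obtain ⟨d, rfl⟩ := Nat.exists_eq_succ_of_ne_zero hd
  have h0 : (q : ℝ) ≠ 0 := by positivity
  have h3 : (q : ℝ) + 1 ≠ 0 := by positivity
  simp only [radialMean, Nat.succ_eq_add_one, pow_succ]
  field_simp

/-- Off the root, `s^d` is an eigenfunction of averaging with eigenvalue `(1/s + q s)/(q + 1)`,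
which is below 1 exactly for `1/q < s < 1`. The choice `s = 2/(q + 1)` is the harmonic mean of the
endpoints. -/
theorem radialMean_pow_le {q : ℕ} (hq : 2 ≤ q) (d : ℕ) :
    radialMean q (fun n => 2 * (2 / ((q : ℝ) + 1)) ^ n) d ≤
      (1 / 2 + 2 * q / ((q : ℝ) + 1) ^ 2) * (2 * (2 / ((q : ℝ) + 1)) ^ d) := by
  have h2 : (2 : ℝ) ≤ q := by exact_mod_cast hq
  have h3 : 0 < (q : ℝ) + 1 := by linarith
  rcases d with _ | d
  · simp only [radialMean, pow_one, pow_zero, mul_one]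
    have : (1 / 2 + 2 * q / ((q : ℝ) + 1) ^ 2) * 2 - 2 * (2 / ((q : ℝ) + 1)) =
        (((q : ℝ) + 1) ^ 2 - 4) / ((q : ℝ) + 1) ^ 2 := by
      field_simp
      ring
    have h4 : 0 ≤ (((q : ℝ) + 1) ^ 2 - 4) / ((q : ℝ) + 1) ^ 2 :=
      div_nonneg (by nlinarith) (by positivity)
    linarith
  · refine le_of_eq ?_
    simp only [radialMean, pow_succ]
    field_simp

theorem subsetGreen_le_treeGreen (hG : G.IsTree) {q : ℕ} (hq : 2 ≤ q)
    (hreg : G.IsRegularOfDegree (q + 1)) (A : Set V) (o x : V) :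
    subsetGreen G A x o ≤ treeGreen G q x o := by
  classical
  have h2 : (2 : ℝ) ≤ q := by exact_mod_cast hq
  rw [treeGreen_eq]
  refine subsetGreen_le_ofReal (fun v => by rw [hreg v]; omega) A o
    (u := fun v => (q : ℝ) / (q - 1) * ((q : ℝ) ^ G.dist o v)⁻¹) (fun v => ?_) (fun v => ?_) x
  · exact mul_nonneg (div_nonneg (by linarith) (by linarith)) (by positivity)
  · have h := radialMean_green hq 0 (G.dist o v)
    simp only [sub_zero] at h
    rw [average_radial hG hreg o v fun n => (q : ℝ) / (q - 1) * ((q : ℝ) ^ n)⁻¹, ← h]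
    simp only [hG.connected.dist_eq_zero_iff, eq_comm (a := o), le_refl]

theorem exists_truncation_level {q : ℕ} (hq : 2 ≤ q) {t : ℝ} (ht0 : 0 < t) (ht1 : t < 1) :
    ∃ m : ℕ, ∀ d : ℕ, t < ((q : ℝ) ^ d)⁻¹ ↔ d ≤ m := by
  classical
  have h2 : (2 : ℝ) ≤ q := by exact_mod_cast hq
  have hex : ∃ n : ℕ, ((q : ℝ) ^ n)⁻¹ ≤ t := by
    obtain ⟨n, hn⟩ := exists_pow_lt_of_lt_one ht0 (show (q : ℝ)⁻¹ < 1 from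
      inv_lt_one_of_one_lt₀ (by linarith))
    exact ⟨n, by rw [← inv_pow]; exact hn.le⟩
  have hpos : Nat.find hex ≠ 0 := fun h => by
    have := Nat.find_spec hex
    rw [h] at this
    norm_num at this
    linarith
  refine ⟨Nat.find hex - 1, fun d => ⟨fun h => ?_, fun h => ?_⟩⟩
  · by_contra! hlt
    have := inv_pow_anti (q := q) (by omega) (show Nat.find hex ≤ d by omega)
    linarith [Nat.find_spec hex]
  · exact not_le.1 (Nat.find_min hex (by omega))

theorem inv_pow_le_subsetGreen_truncatedTree (hG : G.IsTree) {q : ℕ} (hq : 2 ≤ q)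
    (hreg : G.IsRegularOfDegree (q + 1)) (o : V) (E : Set (Ends G)) {t : ℝ} (ht0 : 0 < t)
    (ht1 : t < 1) {x : V} (hx : x ∈ truncatedTree G q o E t) :
    ENNReal.ofReal ((q : ℝ) ^ G.dist o x)⁻¹ ≤ subsetGreen G (truncatedTree G q o E t) x o := by
  classical
  have h2 : (2 : ℝ) ≤ q := by exact_mod_cast hq
  have hq1 : 0 < (q : ℝ) - 1 := by linarith
  have hq0 : (0 : ℝ) < q := by linarith
  obtain ⟨m, hm⟩ := exists_truncation_level hq ht0 ht1
  set A := truncatedTree G q o E t with hAdef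
  set k : ℕ → ℝ := fun n => ((q : ℝ) ^ n)⁻¹ with hk
  have hk0 : ∀ n, 0 < k n := fun n => by positivity
  have hkanti : ∀ {a b}, a ≤ b → k b ≤ k a := fun h => inv_pow_anti (by omega) h
  -- The subtracted constant makes `g` vanish at level `m + 1` and equal `k` at level `m`.
  set g : ℕ → ℝ := fun n => (q : ℝ) / (q - 1) * k n - k m / (q - 1) with hg
  set f : V → ℝ := fun v => if v ∈ A ∧ m < G.dist o v then k (G.dist o v) else g (G.dist o v)
    with hf
  have hgk : ∀ n, g n - k n = (k n - k m) / (q - 1) := fun n => by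
    simp only [hg]
    field_simp
    ring
  have hgf : ∀ v, g (G.dist o v) ≤ f v := fun v => by
    simp only [hf]
    split_ifs with h
    · have h1 := hgk (G.dist o v)
      have h3 : (k (G.dist o v) - k m) / (q - 1) ≤ 0 :=
        div_nonpos_of_nonpos_of_nonneg (by linarith [hkanti h.2.le]) hq1.le
      linarith
    · exact le_rfl
  have hkf : ∀ v ∈ A, k (G.dist o v) ≤ f v := fun v hv => by
    simp only [hf]
    split_ifs with h
    · exact le_rfl
    · have hle : G.dist o v ≤ m := not_lt.1 fun h' => h ⟨hv, h'⟩
      have h1 := hgk (G.dist o v)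
      have h3 : 0 ≤ (k (G.dist o v) - k m) / (q - 1) :=
        div_nonneg (by linarith [hkanti hle]) hq1.le
      linarith
  refine (ENNReal.ofReal_le_ofReal (hkf x hx)).trans ?_
  -- The truncated tree may be infinite, so the contracted majorant `r` replaces a finite maximum
  -- principle: it decays more slowly than `q^(-d)` yet is strictly contracted by averaging.
  refine ofReal_le_subsetGreen (fun v => by rw [hreg v]; omega) o (f := f)
    (r := fun v => 2 * (2 / ((q : ℝ) + 1)) ^ G.dist o v)
    (c := 1 / 2 + 2 * q / ((q : ℝ) + 1) ^ 2) (by positivity) ?_ ?_ ?_ (fun v => by positivity)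
    ?_ ?_ x
  · have : 2 * q / ((q : ℝ) + 1) ^ 2 < 1 / 2 := by
      rw [div_lt_div_iff₀ (by positivity) (by positivity)]
      nlinarith
    linarith
  · intro v hv
    simp only [hf, hv, false_and, if_false]
    have hlt : m < G.dist o v := by
      by_contra! hle
      exact hv (mem_truncatedTree_of_lt hG (by omega) ((hm _).2 hle))
    have h1 : k (G.dist o v) ≤ k (m + 1) := hkanti hlt
    have h3 : (q : ℝ) * k (m + 1) = k m := by
      simp only [hk, pow_succ]
      field_simp
    have h4 : g (G.dist o v) = (q * k (G.dist o v) - k m) / (q - 1) := by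
      simp only [hg]
      ring
    rw [h4]
    exact div_nonpos_of_nonpos_of_nonneg (by nlinarith) hq1.le
  · intro v hv
    by_cases hvm : m < G.dist o v
    · have hv0 : v ≠ o := by
        rintro rfl
        simp at hvm
      have hmean := radialMean_inv_pow (q := q) (d := G.dist o v) (by omega) (by omega)
      rw [← average_radial hG hreg] at hmean
      rw [if_neg hv0, zero_add, show f v = k (G.dist o v) from if_pos ⟨hv, hvm⟩]
      simp only [hk]
      rw [← hmean]
      -- It suffices that all neighbours of `v` lie in `A`, where `f ≥ k`: the parent always does,
      -- and the children do because `v` is past level `m`.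
      gcongr with z hz
      rw [mem_neighborFinset] at hz
      refine hkf z ?_
      rcases hG.dist_eq_dist_add_one_of_adj o hz with h | h
      · exact mem_truncatedTree_parent hG hv hz.symm h
      · exact mem_truncatedTree_child hG (by omega) hv hz h
          (not_lt.1 fun h' => absurd ((hm _).1 h') (by omega))
    · have hmean := radialMean_green hq (k m / (q - 1)) (G.dist o v)
      rw [← average_radial hG hreg] at hmean
      rw [show f v = g (G.dist o v) from if_neg fun h => hvm h.2]
      simp only [hg, hk] at hmean hgf ⊢
      rw [← hmean]
      simp only [hG.connected.dist_eq_zero_iff, eq_comm (a := o)]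
      -- At levels up to `m`, `f` equals `g`, which solves the Poisson equation, while `f ≥ g` at
      -- every neighbour.
      gcongr with z hz
      exact hgf z
  · intro v
    have h1 : k (G.dist o v) ≤ (2 / ((q : ℝ) + 1)) ^ G.dist o v := by
      simp only [hk]
      rw [← inv_pow]
      refine pow_le_pow_left₀ (by positivity) ?_ _
      rw [inv_eq_one_div, div_le_div_iff₀ hq0 (by positivity)]
      linarith
    have h3 : f v ≤ 2 * k (G.dist o v) := by
      simp only [hf]
      have hkv := hk0 (G.dist o v)
      split_ifs
      · linarith
      · have h4 : (q : ℝ) / (q - 1) ≤ 2 := by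
          rw [div_le_iff₀ hq1]
          linarith
        have h5 : 0 ≤ k m / (q - 1) := div_nonneg (hk0 m).le hq1.le
        simp only [hg]
        nlinarith
    linarith
  · intro v
    rw [average_radial hG hreg o v fun n => 2 * (2 / ((q : ℝ) + 1)) ^ n]
    exact radialMean_pow_le hq _

end RegularTree

end DiskTree

theorem theorem3p5 :
    (∀ (E : Set ℂ), E ⊆ Metric.sphere (0 : ℂ) 1 →
      ∀ t : ℝ, 0 < t → t < 1 / 7 →
      ∀ z ∈ DiskTree.truncatedDisk E (7 * t),
        DiskTree.diskGreen z 0 ≥ DiskTree.domainGreen (DiskTree.truncatedDisk E t) z 0 ∧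
        DiskTree.domainGreen (DiskTree.truncatedDisk E t) z 0 ≥ 1 / 18 * DiskTree.diskGreen z 0 ∧
        1 / 18 * DiskTree.diskGreen z 0 ≥ 1 / 18 * Metric.infEDist z (Metric.sphere (0 : ℂ) 1)) ∧
    (∀ (q : ℕ), 2 ≤ q →
      ∀ (V : Type*) (G : SimpleGraph V) [G.LocallyFinite],
      G.IsTree → G.IsRegularOfDegree (q + 1) →
      ∀ (o : V) (E : Set (DiskTree.Ends G)) (t : ℝ), 0 < t → t < 1 →
      ∀ x ∈ DiskTree.truncatedTree G q o E t,
        DiskTree.treeGreen G q x o ≥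
          DiskTree.subsetGreen G (DiskTree.truncatedTree G q o E t) x o ∧
        DiskTree.subsetGreen G (DiskTree.truncatedTree G q o E t) x o ≥
          (ENNReal.ofReal ((q : ℝ) / ((q : ℝ) - 1)))⁻¹ * DiskTree.treeGreen G q x o ∧
        (ENNReal.ofReal ((q : ℝ) / ((q : ℝ) - 1)))⁻¹ * DiskTree.treeGreen G q x o ≥
          DiskTree.distToEnds G q o x Set.univ) := by
  refine ⟨fun E hE t ht ht7 z hz => ⟨?_, ?_, ?_⟩,
    fun q hq V G _ hG hreg o E t ht0 ht1 x hx => ⟨?_, ?_, ?_⟩⟩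
  · exact DiskTree.domainGreen_le_diskGreen (fun w hw => (DiskTree.truncatedDisk_subset hw).1)
      (DiskTree.truncatedDisk_anti (by linarith) hz)
  · exact DiskTree.diskGreen_le_domainGreen_truncatedDisk hE ht ht7 hz
  · exact mul_le_mul_right (DiskTree.infEDist_sphere_le_diskGreen
      (mem_ball_zero_iff.1 (DiskTree.truncatedDisk_subset hz).1)) _
  · exact DiskTree.subsetGreen_le_treeGreen hG hq hreg _ o x
  · rw [DiskTree.inv_mul_treeGreen hq]
    exact DiskTree.inv_pow_le_subsetGreen_truncatedTree hG hq hreg o E ht0 ht1 hx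
  · rw [DiskTree.inv_mul_treeGreen hq]
    exact DiskTree.distToEnds_univ_le hG (fun v => by rw [hreg v]; omega) (by omega) o x
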